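/- **Setting.** Let $\sigma>0$, $g>0$, let $[\![\gamma]\!]\in\mathbb R$ with $-1\le [\![\gamma]\!]/\sigma\le 1$, let $\theta_1,\theta_2>0$ with $\theta_1+\theta_2<\pi$, and let $P_0\in\mathbb R$. Let $\gamma\in[-\frac{\pi}{2},\frac{\pi}{2}]$ be given by $\sin\gamma=-[\![\gamma]\!]/\sigma$ and put $$\psi_1=\gamma+\tfrac{\pi}{2}-\theta_1,\qquad \psi_2=-\gamma-\tfrac{\pi}{2}+\theta_2 .$$ Assume $\psi_1>0>\psi_2$. For a corner $O$, the left wall and the right wall are the closed rays issuing from $O$ at polar angles $\pi-\theta_1$ and $\theta_2$. In the original coordinates $O=(0,0)$; in the shifted coordinates, obtained by $(x,y)\mapsto(x,y-P_0/g)$, $O=(0,-P_0/g)$. A *free surface* is a regular $C^2$ curve $t\mapsto(x(t),y(t))$, $t\in[a,b]$, $a<b$, in the shifted coordinates, together with a continuous slope angle $\psi(t)$, i.e. $(x',y')=\sqrt{x'^2+y'^2}\,(\cos\psi,\sin\psi)$, such that: - the curve meets the left wall exactly at $t=a$ and the right wall exactly at $t=b$, with slope angles $\psi_1$ and $\psi_2$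 there; the continuous branch is normalized by $\psi(a)=\psi_1$, while $\psi(b)=\psi_2$ is required only modulo $2\pi$; - $[a,b]$ splits into finitely many intervals on each of which the curve is a polar graph $r=\rho(\theta)>0$ about $O$, with $\theta\in[\theta_2,\pi-\theta_1]$ depending continuously and injectively on $t$; - the curve does not intersect itself. It *satisfies the shifted Euler–Lagrange system locally* if $$\frac{dx}{d\psi}=\sigma\frac{\cos\psi}{gy},\qquad \frac{dy}{d\psi}=\sigma\frac{\sin\psi}{gy}$$ holds along it in the form $gy\,x'=\sigma\cos\psi\,\psi'$, $gy\,y'=\sigma\sin\psi\,\psi'$ (which also makes sense where $y=0$ or where $\psi$ is not a parameter). The *$\psi$-system* for functions $X,Y$ on $[\psi_2,\psi_1]$ (original coordinates) is: $gY-P_0\neq0$, $$\frac{dX}{d\psi}=\sigma\frac{\cos\psi}{gY-P_0},\qquad \frac{dY}{d\psi}=\sigma\frac{\sin\psi}{gY-P_0}\quad\text{on }[\psi_2,\psi_1],$$ with $(X,Y)(\psi_1)$ on the left wall and $(X,Y)(\psi_2)$ on the right wall. **Theorem.** 1. Let a free surface satisfy the shifted Euler–Lagrange system locally. Then its height $y$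 attains its maximum at exactly one point $(x_m,u_m)$, and $u_m<0$. Moreover $\psi$ is a bijection from $[a,b]$ onto $[\psi_2,\psi_1]$: the curve is globally parametrized, one-to-one, by its slope angle. 2. A free surface satisfies the shifted Euler–Lagrange system locally if and only if $\psi:[a,b]\to[\psi_2,\psi_1]$ is a bijection and the curve, parametrized by $\psi$ and shifted back to the original coordinates (that is, $X(\psi(t))=x(t)$, $Y(\psi(t))=y(t)+P_0/g$), solves the $\psi$-system. 3. Let $\rho\in C^2([\theta_2,\pi-\theta_1])$ be positive. Then $\rho$ solves the original Euler–Lagrange system $$g\rho^2\sin\theta+\sigma\frac{\rho}{\sqrt{\rho^2+\rho'^2}}-\sigma\,\partial_\theta\Big(\frac{\rho'}{\sqrt{\rho^2+\rho'^2}}\Big)-P_0\,\rho=0\ \text{ on }[\theta_2,\pi-\theta_1],$$ $$\frac{\rho'}{\sqrt{\rho^2+\rho'^2}}(\theta_2)=-\frac{[\![\gamma]\!]}{\sigma},\qquad \frac{\rho'}{\sqrt{\rho^2+\rho'^2}}(\pi-\theta_1)=\frac{[\![\gamma]\!]}{\sigma}$$ if and only if there is a continuous slope angle $\psi(\theta)$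 of its graph, i.e. $$\cos\psi=\frac{\rho\sin\theta-\rho'\cos\theta}{\sqrt{\rho^2+\rho'^2}},\qquad \sin\psi=-\frac{\rho'\sin\theta+\rho\cos\theta}{\sqrt{\rho^2+\rho'^2}},$$ with $\psi(\pi-\theta_1)=\psi_1$ and $\psi(\theta_2)=\psi_2$, which maps $[\theta_2,\pi-\theta_1]$ bijectively onto $[\psi_2,\psi_1]$, and functions $X,Y$ solving the $\psi$-system with $X(\psi(\theta))=\rho(\theta)\cos\theta$ and $Y(\psi(\theta))=\rho(\theta)\sin\theta$ for all $\theta\in[\theta_2,\pi-\theta_1]$. -/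

import Mathlib

/-- Physical and geometric constants: surface tension `σ`, gravity `g`, the jump
`jump = γ_sv - γ_sf` of the wall energies, and the inclination angles `θ₁` (left wall) and
`θ₂` (right wall). -/
structure Setup where
  σ : ℝ
  g : ℝ
  jump : ℝ
  θ₁ : ℝ
  θ₂ : ℝ
  σ_pos : 0 < σ
  g_pos : 0 < g
  neg_one_le : -1 ≤ jump / σ
  le_one : jump / σ ≤ 1
  θ₁_pos : 0 < θ₁
  θ₂_pos : 0 < θ₂
  angle_sum_lt : θ₁ + θ₂ < Real.pi

namespace Setup

/-- The angle `γ ∈ [-π/2, π/2]` with `sin γ = -jump / σ`. -/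
noncomputable def γ (p : Setup) : ℝ := Real.arcsin (-(p.jump / p.σ))

/-- Slope angle prescribed at the left wall. -/
noncomputable def ψ₁ (p : Setup) : ℝ := p.γ + Real.pi / 2 - p.θ₁

/-- Slope angle prescribed at the right wall. -/
noncomputable def ψ₂ (p : Setup) : ℝ := -p.γ - Real.pi / 2 + p.θ₂

theorem sin_ψ₁ (p : Setup) :
    Real.sin p.ψ₁ = -(p.jump / p.σ) * Real.sin p.θ₁
      + Real.sqrt (1 - (p.jump / p.σ) ^ 2) * Real.cos p.θ₁ := by
  have h : p.ψ₁ = (p.γ - p.θ₁) + Real.pi / 2 := by unfold ψ₁; ring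
  rw [h, Real.sin_add_pi_div_two, Real.cos_sub, γ,
    Real.sin_arcsin (by linarith [p.le_one]) (by linarith [p.neg_one_le]), Real.cos_arcsin, neg_sq]
  ring

theorem sin_ψ₂ (p : Setup) :
    Real.sin p.ψ₂ = (p.jump / p.σ) * Real.sin p.θ₂
      - Real.sqrt (1 - (p.jump / p.σ) ^ 2) * Real.cos p.θ₂ := by
  have h : p.ψ₂ = (p.θ₂ - p.γ) - Real.pi / 2 := by unfold ψ₂; ring
  rw [h, Real.sin_sub_pi_div_two, Real.cos_sub, γ,
    Real.sin_arcsin (by linarith [p.le_one]) (by linarith [p.neg_one_le]), Real.cos_arcsin, neg_sq]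
  ring

/-- `(x, y)` lies on the left wall: the ray at polar angle `π - θ₁` from the corner `(0, h)`. -/
def OnLeftWall (p : Setup) (h x y : ℝ) : Prop :=
  ∃ r : ℝ, 0 ≤ r ∧ x = r * Real.cos (Real.pi - p.θ₁) ∧ y = h + r * Real.sin (Real.pi - p.θ₁)

/-- `(x, y)` lies on the right wall: the ray at polar angle `θ₂` from the corner `(0, h)`. -/
def OnRightWall (p : Setup) (h x y : ℝ) : Prop :=
  ∃ r : ℝ, 0 ≤ r ∧ x = r * Real.cos p.θ₂ ∧ y = h + r * Real.sin p.θ₂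

/-- On the parameter interval `[c, d]` the curve `(x, y)` is a graph `r = ρ(θ)` in polar
coordinates centred at the corner `(0, h)`, with `θ` in the angular range of the vessel; `φ t` is
the polar angle of the point with parameter `t`. -/
def IsPolarPiece (p : Setup) (h : ℝ) (x y : ℝ → ℝ) (c d : ℝ) : Prop :=
  ∃ ρ φ : ℝ → ℝ, ContinuousOn φ (Set.Icc c d) ∧ Set.InjOn φ (Set.Icc c d) ∧
    ∀ t ∈ Set.Icc c d, φ t ∈ Set.Icc p.θ₂ (Real.pi - p.θ₁) ∧ 0 < ρ (φ t) ∧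
      x t = ρ (φ t) * Real.cos (φ t) ∧ y t = h + ρ (φ t) * Real.sin (φ t)

/-- The curve splits into finitely many polar graphs. -/
def IsPiecewisePolar (p : Setup) (h : ℝ) (a b : ℝ) (x y : ℝ → ℝ) : Prop :=
  ∃ (n : ℕ) (τ : ℕ → ℝ), τ 0 = a ∧ τ n = b ∧
    ∀ i < n, τ i < τ (i + 1) ∧ p.IsPolarPiece h x y (τ i) (τ (i + 1))

end Setup

/-- Speed of the curve `(x, y)` on `[a, b]` (one-sided derivatives at the end points). -/
noncomputable def curveSpeed (a b : ℝ) (x y : ℝ → ℝ) (t : ℝ) : ℝ :=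
  Real.sqrt ((derivWithin x (Set.Icc a b) t) ^ 2 + (derivWithin y (Set.Icc a b) t) ^ 2)

/-- `ψ` is a continuous slope angle along the curve: the unit tangent is `(cos ψ, sin ψ)`. -/
structure IsSlopeAngle (a b : ℝ) (x y ψ : ℝ → ℝ) : Prop where
  continuousOn : ContinuousOn ψ (Set.Icc a b)
  cos_eq : ∀ t ∈ Set.Icc a b,
    derivWithin x (Set.Icc a b) t = curveSpeed a b x y t * Real.cos (ψ t)
  sin_eq : ∀ t ∈ Set.Icc a b,
    derivWithin y (Set.Icc a b) t = curveSpeed a b x y t * Real.sin (ψ t)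

namespace Setup

/-- A simple regular `C²` curve `t ↦ (x t, y t)`, `t ∈ [a, b]`, with slope angle `ψ`, running from
the left wall to the right wall, in the shifted coordinates where the corner of the vessel is
`(0, -P₀ / g)`. It meets each wall exactly once, there with slope angles `ψ₁` and `ψ₂`. The
continuous branch `ψ` starts at `ψ₁`; the slope angle at the right wall is prescribed as an angle,
that is, modulo `2π`. -/
structure IsFreeSurface (p : Setup) (P₀ a b : ℝ) (x y ψ : ℝ → ℝ) : Prop where
  lt : a < b
  contDiffOn_x : ContDiffOn ℝ 2 x (Set.Icc a b)
  contDiffOn_y : ContDiffOn ℝ 2 y (Set.Icc a b)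
  regular : ∀ t ∈ Set.Icc a b, 0 < curveSpeed a b x y t
  simple : Set.InjOn (fun t => (x t, y t)) (Set.Icc a b)
  left_wall : ∀ t ∈ Set.Icc a b, p.OnLeftWall (-P₀ / p.g) (x t) (y t) ↔ t = a
  right_wall : ∀ t ∈ Set.Icc a b, p.OnRightWall (-P₀ / p.g) (x t) (y t) ↔ t = b
  polar : p.IsPiecewisePolar (-P₀ / p.g) a b x y
  slope : IsSlopeAngle a b x y ψ
  slope_left : ψ a = p.ψ₁
  slope_right : ∃ k : ℤ, ψ b = p.ψ₂ + 2 * Real.pi * k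

/-- The shifted Euler-Lagrange system `dx/dψ = σ cos ψ / (g y)`, `dy/dψ = σ sin ψ / (g y)`, required
locally along the curve. It is written as `g y dx = σ cos ψ dψ`, `g y dy = σ sin ψ dψ`, so that it
makes sense without assuming `y ≠ 0` or that `ψ` is a parameter. -/
def SolvesShiftedEL (p : Setup) (a b : ℝ) (x y ψ : ℝ → ℝ) : Prop :=
  ∀ t ∈ Set.Icc a b, ∃ ψ' : ℝ, HasDerivWithinAt ψ ψ' (Set.Icc a b) t ∧
    p.g * y t * derivWithin x (Set.Icc a b) t = p.σ * Real.cos (ψ t) * ψ' ∧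
    p.g * y t * derivWithin y (Set.Icc a b) t = p.σ * Real.sin (ψ t) * ψ'

/-- The system in the parameter `ψ ∈ [ψ₂, ψ₁]`, in the original coordinates (corner at the
origin): `dX/dψ = σ cos ψ / (g Y - P₀)`, `dY/dψ = σ sin ψ / (g Y - P₀)`, with the point of slope
angle `ψ₁` on the left wall and the point of slope angle `ψ₂` on the right wall. -/
structure SolvesPsiSystem (p : Setup) (P₀ : ℝ) (X Y : ℝ → ℝ) : Prop where
  ne_zero : ∀ s ∈ Set.Icc p.ψ₂ p.ψ₁, p.g * Y s - P₀ ≠ 0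
  deriv_X : ∀ s ∈ Set.Icc p.ψ₂ p.ψ₁,
    HasDerivWithinAt X (p.σ * Real.cos s / (p.g * Y s - P₀)) (Set.Icc p.ψ₂ p.ψ₁) s
  deriv_Y : ∀ s ∈ Set.Icc p.ψ₂ p.ψ₁,
    HasDerivWithinAt Y (p.σ * Real.sin s / (p.g * Y s - P₀)) (Set.Icc p.ψ₂ p.ψ₁) s
  left_wall : p.OnLeftWall 0 (X p.ψ₁) (Y p.ψ₁)
  right_wall : p.OnRightWall 0 (X p.ψ₂) (Y p.ψ₂)

/-- The curve (given in shifted coordinates) is globally and bijectively parametrized by its slope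
angle `ψ ∈ [ψ₂, ψ₁]`, and this parametrization, shifted back, solves the `ψ`-system. -/
def SolvesViaSlopeAngle (p : Setup) (P₀ a b : ℝ) (x y ψ : ℝ → ℝ) : Prop :=
  Set.BijOn ψ (Set.Icc a b) (Set.Icc p.ψ₂ p.ψ₁) ∧
    ∃ X Y : ℝ → ℝ, (∀ t ∈ Set.Icc a b, X (ψ t) = x t ∧ Y (ψ t) = y t + P₀ / p.g) ∧
      p.SolvesPsiSystem P₀ X Y

/-- The angular range of the vessel. -/
def angleRange (p : Setup) : Set ℝ := Set.Icc p.θ₂ (Real.pi - p.θ₁)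

/-- `ρ'(θ)`, one-sided at the ends of the angular range. -/
noncomputable def polarDeriv (p : Setup) (ρ : ℝ → ℝ) (θ : ℝ) : ℝ := derivWithin ρ p.angleRange θ

/-- `√(ρ² + ρ'²)`. -/
noncomputable def polarSpeed (p : Setup) (ρ : ℝ → ℝ) (θ : ℝ) : ℝ :=
  Real.sqrt (ρ θ ^ 2 + p.polarDeriv ρ θ ^ 2)

/-- The original Euler-Lagrange system for a polar graph `r = ρ(θ)`: the differential equation and
the two contact angle conditions (the natural boundary conditions of the energy). -/
structure SolvesPolarEL (p : Setup) (P₀ : ℝ) (ρ : ℝ → ℝ) : Prop where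
  equation : ∀ θ ∈ p.angleRange,
    p.g * ρ θ ^ 2 * Real.sin θ + p.σ * (ρ θ / p.polarSpeed ρ θ)
      - p.σ * derivWithin (fun s => p.polarDeriv ρ s / p.polarSpeed ρ s) p.angleRange θ
      - P₀ * ρ θ = 0
  right_contact : p.polarDeriv ρ p.θ₂ / p.polarSpeed ρ p.θ₂ = -(p.jump / p.σ)
  left_contact : p.polarDeriv ρ (Real.pi - p.θ₁) / p.polarSpeed ρ (Real.pi - p.θ₁) = p.jump / p.σ

/-- `ψ(θ)` is a continuous slope angle of the polar graph `r = ρ(θ)`, traversed from the left wall to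
the right wall, that is, in the direction of decreasing `θ`. -/
structure IsPolarSlopeAngle (p : Setup) (ρ ψ : ℝ → ℝ) : Prop where
  continuousOn : ContinuousOn ψ p.angleRange
  cos_eq : ∀ θ ∈ p.angleRange, Real.cos (ψ θ) =
    (ρ θ * Real.sin θ - p.polarDeriv ρ θ * Real.cos θ) / p.polarSpeed ρ θ
  sin_eq : ∀ θ ∈ p.angleRange, Real.sin (ψ θ) =
    -(p.polarDeriv ρ θ * Real.sin θ + ρ θ * Real.cos θ) / p.polarSpeed ρ θ

/-- The slope angle of the polar graph `r = ρ(θ)` is in one-to-one correspondence with `θ`, takes the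
values `ψ₁`, `ψ₂` at the walls, and the graph parametrized by it solves the `ψ`-system. -/
def PolarSolvesViaSlopeAngle (p : Setup) (P₀ : ℝ) (ρ : ℝ → ℝ) : Prop :=
  ∃ ψ : ℝ → ℝ, p.IsPolarSlopeAngle ρ ψ ∧ ψ (Real.pi - p.θ₁) = p.ψ₁ ∧ ψ p.θ₂ = p.ψ₂ ∧
    Set.BijOn ψ p.angleRange (Set.Icc p.ψ₂ p.ψ₁) ∧
    ∃ X Y : ℝ → ℝ, (∀ θ ∈ p.angleRange,
        X (ψ θ) = ρ θ * Real.cos θ ∧ Y (ψ θ) = ρ θ * Real.sin θ) ∧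
      p.SolvesPsiSystem P₀ X Y

end Setup

/-!
In the shifted coordinates the Euler-Lagrange system says that the curvature of the free surface is
`g y / σ`. With the speed `v` this is the pendulum equation `ψ' = (g / σ) y v`, `y' = v sin ψ`,
whose energy `cos ψ + g y² / (2 σ)` is conserved. Suppose that `ψ` starts at `ψ₁ > 0` and ends at
`ψ₂ < 0`. It vanishes somewhere in between, so the energy is at least that of the equilibrium
`ψ = 0`, `y = 0`, and strictly larger, since by uniqueness the equilibrium is not reached. Hence
`y` has no zero. It cannot be positive, as `ψ` would then increase, so `y < 0` and `ψ` decreases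
strictly from `ψ₁` to `ψ₂` (`pendulum_height_neg`, `pendulum_strictAntiOn`). The unique maximum of
`y` is where `ψ = 0`, and with `ψ` as parameter the equation becomes the `ψ`-system
(`Setup.exists_solvesPsiSystem`); conversely the `ψ`-system returns the curvature equation by the
chain rule (`Setup.deriv_slope_of_solvesPsiSystem`), the slope angle of a `C²` curve being
differentiable.

For a free surface the end value of `ψ` is prescribed only modulo `2π`. That there are no further
turns is a case of Hopf's theorem on the turning of tangents, and uses that the curve is simple and
lies between the walls: the continuous angle of the secants (`exists_secant_angle`) connects the
tangent at one end to the tangent at the other through the direction of the chord, and each wall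
confines the secants from its end point to a half plane
(`Setup.IsFreeSurface.slope_right_eq`).

For a polar graph, `ρ' / √(ρ² + ρ'²)` is the sine of the angle `θ - ψ - π / 2` between the graph
and the circles about the corner. In terms of `ψ` the Euler-Lagrange equation is the same curvature
equation and the contact conditions prescribe `ψ` at the walls, so the same analysis applies
(`Setup.IsPolarSlopeAngle.equation_iff`, `Setup.solvesPolarEL_iff`).
-/

/-! ### Calculus on a closed interval -/

/-- A continuous angle whose cosine and sine are differentiable is differentiable. -/
theorem differentiableWithinAt_angle {s : Set ℝ} {t : ℝ} {ψ : ℝ → ℝ}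
    (hψ : ContinuousWithinAt ψ s t)
    (hcos : DifferentiableWithinAt ℝ (fun u => Real.cos (ψ u)) s t)
    (hsin : DifferentiableWithinAt ℝ (fun u => Real.sin (ψ u)) s t) :
    DifferentiableWithinAt ℝ ψ s t := by
  have hsub : DifferentiableWithinAt ℝ (fun u => Real.sin (ψ u - ψ t)) s t := by
    simp only [Real.sin_sub]
    exact (hsin.mul_const _).sub (hcos.mul_const _)
  have harc : DifferentiableAt ℝ Real.arcsin (Real.sin (ψ t - ψ t)) := by
    rw [sub_self, Real.sin_zero]
    exact Real.differentiableAt_arcsin.2 ⟨by norm_num, by norm_num⟩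
  have hcomp : DifferentiableWithinAt ℝ
      (fun u => ψ t + Real.arcsin (Real.sin (ψ u - ψ t))) s t :=
    (harc.comp_differentiableWithinAt t hsub).const_add _
  have hnear : ∀ᶠ u in nhdsWithin t s, ψ u - ψ t ∈ Set.Ioo (-(Real.pi / 2)) (Real.pi / 2) := by
    have h0 : Filter.Tendsto (fun u => ψ u - ψ t) (nhdsWithin t s) (nhds 0) := by
      have h := hψ.tendsto.sub_const (ψ t)
      rwa [sub_self] at h
    exact h0.eventually (Ioo_mem_nhds (by linarith [Real.pi_pos]) (by linarith [Real.pi_pos]))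
  refine hcomp.congr_of_eventuallyEq ?_ (by simp)
  filter_upwards [hnear] with u hu
  rw [Real.arcsin_sin hu.1.le hu.2.le]
  ring

/-- The inverse of a bijection of a compact interval with nonvanishing derivative is
differentiable. -/
theorem hasDerivWithinAt_invFunOn {a b : ℝ} {S : Set ℝ} {f : ℝ → ℝ}
    (hf : ContinuousOn f (Set.Icc a b)) (hbij : Set.BijOn f (Set.Icc a b) S)
    {t m : ℝ} (ht : t ∈ Set.Icc a b) (hm : m ≠ 0)
    (hd : HasDerivWithinAt f m (Set.Icc a b) t) :
    HasDerivWithinAt (Function.invFunOn f (Set.Icc a b)) m⁻¹ S (f t) := by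
  set τ := Function.invFunOn f (Set.Icc a b) with hτ
  have hleft : Set.LeftInvOn τ f (Set.Icc a b) := hbij.injOn.leftInvOn_invFunOn
  have hright : Set.RightInvOn τ f S := hbij.surjOn.rightInvOn_invFunOn
  have hmaps : Set.MapsTo τ S (Set.Icc a b) := hbij.surjOn.mapsTo_invFunOn
  -- The inverse is continuous because `f` maps compact sets to compact sets.
  have hcont : ContinuousOn τ S := by
    rw [continuousOn_iff_isClosed]
    intro K hK
    refine ⟨f '' (K ∩ Set.Icc a b), ?_, ?_⟩
    · exact ((isCompact_Icc.inter_left hK).image_of_continuousOn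
        (hf.mono Set.inter_subset_right)).isClosed
    · ext s
      constructor
      · rintro ⟨hs, hsS⟩
        exact ⟨⟨τ s, ⟨hs, hmaps hsS⟩, hright hsS⟩, hsS⟩
      · rintro ⟨⟨u, ⟨huK, hu⟩, rfl⟩, hsS⟩
        refine ⟨?_, hsS⟩
        change τ (f u) ∈ K
        rwa [hleft hu]
  have hft : f t ∈ S := hbij.mapsTo ht
  have htend : Filter.Tendsto τ (nhdsWithin (f t) S)
      (nhdsWithin (τ (f t)) (Set.Icc a b)) :=
    (hcont (f t) hft).tendsto_nhdsWithin hmaps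
  have hd' : HasFDerivWithinAt f
      ((ContinuousLinearEquiv.unitsEquivAut ℝ (Units.mk0 m hm) : ℝ ≃L[ℝ] ℝ) : ℝ →L[ℝ] ℝ)
      (Set.Icc a b) (τ (f t)) := by
    rw [hleft ht]
    exact hd.hasFDerivWithinAt.congr_fderiv (ContinuousLinearMap.ext_ring (by simp))
  have h := HasFDerivWithinAt.of_local_left_inverse htend hd' hft
    (Filter.eventually_of_mem self_mem_nhdsWithin fun s hs => hright hs)
  exact h.hasDerivWithinAt.congr_deriv (by simp)

/-! ### The pendulum equation for the slope angle -/

/-- Along a solution of `ψ' = κ y v`, `y' = v sin ψ` the energy `cos ψ + κ y² / 2` is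
conserved. -/
theorem pendulum_energy {a b κ : ℝ} (hab : a < b) {ψ y v : ℝ → ℝ}
    (hψ : ∀ t ∈ Set.Icc a b, HasDerivWithinAt ψ (κ * y t * v t) (Set.Icc a b) t)
    (hy : ∀ t ∈ Set.Icc a b, HasDerivWithinAt y (v t * Real.sin (ψ t)) (Set.Icc a b) t) :
    ∀ s ∈ Set.Icc a b, ∀ t ∈ Set.Icc a b,
      Real.cos (ψ s) + κ * y s ^ 2 / 2 = Real.cos (ψ t) + κ * y t ^ 2 / 2 := by
  have hE : ∀ t ∈ Set.Icc a b,
      HasDerivWithinAt (fun u => Real.cos (ψ u) + κ * y u ^ 2 / 2) 0 (Set.Icc a b) t := by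
    intro t ht
    have h := (hψ t ht).cos.add ((((hy t ht).pow 2).const_mul κ).div_const 2)
    refine h.congr_deriv ?_
    push_cast
    ring
  have hconst := constant_of_derivWithin_zero (fun t ht => (hE t ht).differentiableWithinAt)
    (fun t ht => (hE t (Set.Ico_subset_Icc_self ht)).derivWithin
      (uniqueDiffOn_Icc hab t (Set.Ico_subset_Icc_self ht)))
  intro s hs t ht
  rw [hconst s hs, hconst t ht]

/-- The equilibrium `ψ = 0`, `y = 0` is not reached in finite time: a Gronwall estimate for
`ψ² + y²`. -/
theorem pendulum_zero_of_zero {a b κ : ℝ} (hκ : 0 < κ) {ψ y v : ℝ → ℝ}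
    (hv : ContinuousOn v (Set.Icc a b)) (hv0 : ∀ t ∈ Set.Icc a b, 0 < v t)
    (hψ : ∀ t ∈ Set.Icc a b, HasDerivWithinAt ψ (κ * y t * v t) (Set.Icc a b) t)
    (hy : ∀ t ∈ Set.Icc a b, HasDerivWithinAt y (v t * Real.sin (ψ t)) (Set.Icc a b) t)
    {c : ℝ} (hc : c ∈ Set.Icc a b) (hψc : ψ c = 0) (hyc : y c = 0) : ψ a = 0 := by
  obtain ⟨M, hM⟩ := isCompact_Icc.bddAbove_image hv
  have hM' : ∀ t ∈ Set.Icc a b, v t ≤ M := fun t ht => hM ⟨t, ht, rfl⟩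
  set C := M * (κ + 1) with hC
  have hN : ∀ t ∈ Set.Icc a b, HasDerivWithinAt
      (fun u => (ψ u ^ 2 + y u ^ 2) * Real.exp (C * u))
      ((2 * ψ t * (κ * y t * v t) + 2 * y t * (v t * Real.sin (ψ t))) * Real.exp (C * t)
        + (ψ t ^ 2 + y t ^ 2) * (Real.exp (C * t) * C)) (Set.Icc a b) t := by
    intro t ht
    have h1 := ((hψ t ht).pow 2).add ((hy t ht).pow 2)
    have h2 : HasDerivWithinAt (fun u => Real.exp (C * u)) (Real.exp (C * t) * C)
        (Set.Icc a b) t := by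
      simpa using (((hasDerivAt_id t).const_mul C).exp).hasDerivWithinAt
    refine (h1.mul h2).congr_deriv ?_
    simp only [Pi.add_apply, Pi.pow_apply]
    push_cast
    ring
  have hmono : MonotoneOn (fun u => (ψ u ^ 2 + y u ^ 2) * Real.exp (C * u)) (Set.Icc a b) := by
    refine monotoneOn_of_hasDerivWithinAt_nonneg (convex_Icc a b)
      (fun t ht => (hN t ht).continuousWithinAt)
      (fun t ht => (hN t (interior_subset ht)).mono interior_subset) ?_
    intro t ht
    have ht' := interior_subset ht
    have hvt := hv0 t ht'
    have hs : Real.sin (ψ t) ^ 2 ≤ ψ t ^ 2 := sq_le_sq.2 Real.abs_sin_le_abs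
    have h1 : 0 ≤ 2 * ψ t * y t + (ψ t ^ 2 + y t ^ 2) := by nlinarith [sq_nonneg (ψ t + y t)]
    have h2 : 0 ≤ 2 * y t * Real.sin (ψ t) + (ψ t ^ 2 + y t ^ 2) := by
      nlinarith [sq_nonneg (y t + Real.sin (ψ t))]
    have h3 : 0 ≤ (M - v t) * ((κ + 1) * (ψ t ^ 2 + y t ^ 2)) :=
      mul_nonneg (by linarith [hM' t ht']) (by positivity)
    have h4 := mul_nonneg (mul_pos hκ hvt).le h1
    have h5 := mul_nonneg hvt.le h2
    have h6 : 0 ≤ 2 * ψ t * (κ * y t * v t) + 2 * y t * (v t * Real.sin (ψ t))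
        + (ψ t ^ 2 + y t ^ 2) * C := by rw [hC]; linarith
    calc (0 : ℝ) ≤ (2 * ψ t * (κ * y t * v t) + 2 * y t * (v t * Real.sin (ψ t))
        + (ψ t ^ 2 + y t ^ 2) * C) * Real.exp (C * t) := mul_nonneg h6 (Real.exp_pos _).le
      _ = _ := by ring
  have h := hmono (Set.left_mem_Icc.2 (hc.1.trans hc.2)) hc hc.1
  simp only [hψc, hyc] at h
  have h' : (ψ a ^ 2 + y a ^ 2) ≤ 0 := by
    by_contra! hpos
    have := mul_pos hpos (Real.exp_pos (C * a))
    linarith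
  nlinarith [sq_nonneg (ψ a), sq_nonneg (y a)]

/-- If the slope angle starts positive and ends negative, the energy exceeds that of the
equilibrium, so the height has no zero; were it positive, the slope angle would increase. -/
theorem pendulum_height_neg {a b κ : ℝ} (hab : a < b) (hκ : 0 < κ) {ψ y v : ℝ → ℝ}
    (hv : ContinuousOn v (Set.Icc a b)) (hv0 : ∀ t ∈ Set.Icc a b, 0 < v t)
    (hψ : ∀ t ∈ Set.Icc a b, HasDerivWithinAt ψ (κ * y t * v t) (Set.Icc a b) t)
    (hy : ∀ t ∈ Set.Icc a b, HasDerivWithinAt y (v t * Real.sin (ψ t)) (Set.Icc a b) t)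
    (ha : 0 < ψ a) (hb : ψ b < 0) : ∀ t ∈ Set.Icc a b, y t < 0 := by
  have hψc : ContinuousOn ψ (Set.Icc a b) := fun t ht => (hψ t ht).continuousWithinAt
  have hyc : ContinuousOn y (Set.Icc a b) := fun t ht => (hy t ht).continuousWithinAt
  obtain ⟨c, hc, hc0⟩ := intermediate_value_Icc' hab.le hψc ⟨hb.le, ha.le⟩
  have hne : ∀ t ∈ Set.Icc a b, y t ≠ 0 := by
    intro t ht h0
    have hE := pendulum_energy hab hψ hy c hc t ht
    rw [hc0, h0, Real.cos_zero] at hE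
    have hcos := Real.cos_le_one (ψ t)
    have hy0 : y c = 0 := by
      have h1 : κ * y c ^ 2 ≤ 0 := by nlinarith
      have h2 : y c ^ 2 ≤ 0 := by
        by_contra! hpos
        have := mul_pos hκ hpos
        linarith
      exact pow_eq_zero_iff two_ne_zero |>.1 (le_antisymm h2 (sq_nonneg _))
    exact ha.ne' (pendulum_zero_of_zero hκ hv hv0 hψ hy hc hc0 hy0)
  by_contra! hcon
  obtain ⟨t₀, ht₀, hpos⟩ := hcon
  have hall : ∀ t ∈ Set.Icc a b, 0 < y t := by
    intro t ht
    by_contra! hle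
    obtain ⟨s, hs, hs0⟩ := isPreconnected_Icc.intermediate_value ht ht₀ hyc ⟨hle, hpos⟩
    exact hne s hs hs0
  have hmono : StrictMonoOn ψ (Set.Icc a b) :=
    strictMonoOn_of_hasDerivWithinAt_pos (convex_Icc a b) hψc
      (fun t ht => (hψ t (interior_subset ht)).mono interior_subset)
      (fun t ht => mul_pos (mul_pos hκ (hall t (interior_subset ht)))
        (hv0 t (interior_subset ht)))
  have := hmono (Set.left_mem_Icc.2 hab.le) (Set.right_mem_Icc.2 hab.le) hab
  linarith

/-- Under the hypotheses of `pendulum_height_neg` the slope angle is a strictly decreasing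
parameter. -/
theorem pendulum_strictAntiOn {a b κ : ℝ} (hab : a < b) (hκ : 0 < κ) {ψ y v : ℝ → ℝ}
    (hv : ContinuousOn v (Set.Icc a b)) (hv0 : ∀ t ∈ Set.Icc a b, 0 < v t)
    (hψ : ∀ t ∈ Set.Icc a b, HasDerivWithinAt ψ (κ * y t * v t) (Set.Icc a b) t)
    (hy : ∀ t ∈ Set.Icc a b, HasDerivWithinAt y (v t * Real.sin (ψ t)) (Set.Icc a b) t)
    (ha : 0 < ψ a) (hb : ψ b < 0) : StrictAntiOn ψ (Set.Icc a b) := by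
  have hneg := pendulum_height_neg hab hκ hv hv0 hψ hy ha hb
  exact strictAntiOn_of_hasDerivWithinAt_neg (convex_Icc a b)
    (fun t ht => (hψ t ht).continuousWithinAt)
    (fun t ht => (hψ t (interior_subset ht)).mono interior_subset)
    (fun t ht => mul_neg_of_neg_of_pos
      (mul_neg_of_pos_of_neg hκ (hneg t (interior_subset ht))) (hv0 t (interior_subset ht)))

theorem bijOn_Icc_of_strictAntiOn {a b : ℝ} (hab : a ≤ b) {f : ℝ → ℝ}
    (hf : ContinuousOn f (Set.Icc a b)) (hanti : StrictAntiOn f (Set.Icc a b)) :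
    Set.BijOn f (Set.Icc a b) (Set.Icc (f b) (f a)) :=
  ⟨fun _ ht => ⟨hanti.antitoneOn ht (Set.right_mem_Icc.2 hab) ht.2,
      hanti.antitoneOn (Set.left_mem_Icc.2 hab) ht ht.1⟩,
    hanti.injOn, intermediate_value_Icc' hab hf⟩

/-! ### The direction of secants -/

/-- A continuous angle whose sine is negative off one point, where the angle lies in `(-π, 0]`,
has its other values in `(-π, 0)`. -/
theorem mem_Ioo_of_sin_neg {S : Set ℝ} (hS : IsPreconnected S) {h : ℝ → ℝ}
    (hc : ContinuousOn h S) {p : ℝ} (hp : p ∈ S) (hp0 : h p ∈ Set.Ioc (-Real.pi) 0)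
    (hsin : ∀ t ∈ S, t ≠ p → Real.sin (h t) < 0) {q : ℝ} (hq : q ∈ S) (hqp : q ≠ p) :
    h q ∈ Set.Ioo (-Real.pi) 0 := by
  have hpi := Real.pi_pos
  constructor
  · by_contra! hle
    obtain ⟨t, ht, hht⟩ := hS.intermediate_value hq hp hc ⟨hle, hp0.1.le⟩
    by_cases htp : t = p
    · rw [htp] at hht
      exact hp0.1.ne' hht
    · have := hsin t ht htp
      rw [hht] at this
      simp at this
  · by_contra! hge
    rcases le_total (h q) (Real.pi / 2) with hlt | hgt
    · have := hsin q hq hqp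
      have := Real.sin_nonneg_of_nonneg_of_le_pi hge (by linarith)
      linarith
    · obtain ⟨t, ht, hht⟩ := hS.intermediate_value hp hq hc
        (show Real.pi / 2 ∈ Set.Icc (h p) (h q) from ⟨by linarith [hp0.2], hgt⟩)
      by_cases htp : t = p
      · rw [htp] at hht
        linarith [hp0.2]
      · have := hsin t ht htp
        rw [hht, Real.sin_pi_div_two] at this
        linarith

/-- A nonvanishing continuous function on the plane has a continuous argument. -/
theorem exists_continuous_arg {q : ℝ × ℝ → ℂ} (hq : Continuous q) (hq0 : ∀ w, q w ≠ 0)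
    (w₀ : ℝ × ℝ) {α : ℝ} (hα : q w₀ = ‖q w₀‖ * Complex.exp (α * Complex.I)) :
    ∃ Θ : ℝ × ℝ → ℝ, Continuous Θ ∧ Θ w₀ = α ∧
      ∀ w, q w = ‖q w‖ * Complex.exp (Θ w * Complex.I) := by
  have hpos : 0 < ‖q w₀‖ := norm_pos_iff.2 (hq0 w₀)
  have he : Complex.exp (Real.log ‖q w₀‖ + α * Complex.I) = q w₀ := by
    rw [Complex.exp_add, ← Complex.ofReal_exp, Real.exp_log hpos, ← hα]
  obtain ⟨F, ⟨hF0, hF⟩, -⟩ := Complex.isCoveringMapOn_exp.existsUnique_continuousMap_lifts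
    ⟨q, hq⟩ he (fun w => hq0 w)
  refine ⟨fun w => (F w).im, Complex.continuous_im.comp F.continuous, ?_, ?_⟩
  · simp [hF0]
  · intro w
    have hw : Complex.exp (F w) = q w := congrFun hF w
    have hn : ‖q w‖ = Real.exp (F w).re := by rw [← hw, Complex.norm_exp]
    rw [hn, Complex.ofReal_exp, ← Complex.exp_add, Complex.re_add_im, hw]

/-- Hopf's construction: along a simple regular curve the directions of the secants from the
points with parameter `s` to those with parameter `t > s`, and of the tangents for `s = t`, have a
joint continuous angle `Θ (s, t)`, which extends the given slope angle `ψ`. The direction is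
that of the mean `∫ u in 0..1, z' (s + u (t - s))` of the velocity, which is continuous up to and
across the diagonal. -/
theorem exists_secant_angle {a b : ℝ} (hab : a < b) {x y ψ v : ℝ → ℝ}
    (hv : ContinuousOn v (Set.Icc a b)) (hv0 : ∀ t ∈ Set.Icc a b, 0 < v t)
    (hψ : ContinuousOn ψ (Set.Icc a b))
    (hx : ∀ t ∈ Set.Icc a b, HasDerivWithinAt x (v t * Real.cos (ψ t)) (Set.Icc a b) t)
    (hy : ∀ t ∈ Set.Icc a b, HasDerivWithinAt y (v t * Real.sin (ψ t)) (Set.Icc a b) t)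
    (hinj : Set.InjOn (fun t => (x t, y t)) (Set.Icc a b)) :
    ∃ Θ : ℝ × ℝ → ℝ, Continuous Θ ∧ (∀ t ∈ Set.Icc a b, Θ (t, t) = ψ t) ∧
      ∀ s ∈ Set.Icc a b, ∀ t ∈ Set.Icc a b, s < t → ∃ r : ℝ, 0 < r ∧
        x t - x s = r * Real.cos (Θ (s, t)) ∧ y t - y s = r * Real.sin (Θ (s, t)) := by
  set z : ℝ → ℂ := fun t => x t + y t * Complex.I with hz
  set z' : ℝ → ℂ := fun t => v t * Complex.exp (ψ t * Complex.I) with hz'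
  have hzd : ∀ t ∈ Set.Icc a b, HasDerivWithinAt z (z' t) (Set.Icc a b) t := by
    intro t ht
    refine (((hx t ht).ofReal_comp).add
      (((hy t ht).ofReal_comp).mul_const Complex.I)).congr_deriv ?_
    simp only [hz']
    rw [Complex.exp_mul_I]
    push_cast
    ring
  have hzc : ContinuousOn z' (Set.Icc a b) :=
    (Complex.continuous_ofReal.comp_continuousOn hv).mul
      (((Complex.continuous_ofReal.comp_continuousOn hψ).mul continuousOn_const).cexp)
  -- The velocity, extended to the line by its end values.
  set G : ℝ → ℂ := Set.IccExtend hab.le ((Set.Icc a b).domRestrict z') with hG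
  have hGc : Continuous G := (continuousOn_iff_continuous_domRestrict.1 hzc).Icc_extend'
  have hGz : ∀ t ∈ Set.Icc a b, G t = z' t := fun t ht => Set.IccExtend_of_mem hab.le _ ht
  set π : ℝ → ℝ := fun t => Set.projIcc a b hab.le t with hπ
  have hπc : Continuous π := continuous_subtype_val.comp continuous_projIcc
  have hπm : ∀ t, π t ∈ Set.Icc a b := fun t => (Set.projIcc a b hab.le t).2
  have hπe : ∀ t ∈ Set.Icc a b, π t = t := fun t ht => by
    simp [hπ, Set.projIcc_of_mem hab.le ht]
  set m : ℝ × ℝ → ℂ := fun w => ∫ u in (0 : ℝ)..1, G (w.1 + (w.2 - w.1) * u) with hm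
  have hmc : Continuous m :=
    intervalIntegral.continuous_parametric_intervalIntegral_of_continuous'
      (by simp only [Function.uncurry_def]; fun_prop) 0 1
  have hmd : ∀ t, m (t, t) = G t := fun t => by simp [hm]
  have hsec : ∀ s ∈ Set.Icc a b, ∀ t ∈ Set.Icc a b, s < t →
      ((t - s : ℝ) : ℂ) * m (s, t) = z t - z s := by
    intro s hs t ht hst
    have hsub : Set.Icc s t ⊆ Set.Icc a b := Set.Icc_subset_Icc hs.1 ht.2
    have h1 : ∫ u in s..t, G u = z t - z s := by
      refine intervalIntegral.integral_eq_sub_of_hasDerivAt_of_le hst.le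
        (fun u hu => ((hzd u (hsub hu)).continuousWithinAt).mono hsub) (fun u hu => ?_)
        (hGc.intervalIntegrable _ _)
      rw [hGz u (hsub (Set.Ioo_subset_Icc_self hu))]
      exact (hzd u (hsub (Set.Ioo_subset_Icc_self hu))).hasDerivAt
        (Icc_mem_nhds (hs.1.trans_lt hu.1) (hu.2.trans_le ht.2))
    have h2 := intervalIntegral.smul_integral_comp_add_mul (a := 0) (b := 1) G (t - s) s
    rw [mul_zero, mul_one, add_zero, add_sub_cancel] at h2
    rw [← h1, ← Complex.real_smul]
    exact h2
  have hz'0 : ∀ t ∈ Set.Icc a b, z' t ≠ 0 := fun t ht =>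
    mul_ne_zero (by exact_mod_cast (hv0 t ht).ne') (Complex.exp_ne_zero _)
  have hzinj : ∀ s ∈ Set.Icc a b, ∀ t ∈ Set.Icc a b, s < t → z t - z s ≠ 0 := by
    intro s hs t ht hst h0
    have hre := congrArg Complex.re h0
    have him := congrArg Complex.im h0
    simp [hz] at hre him
    exact hst.ne (hinj hs ht (Prod.ext (by simp; linarith) (by simp; linarith)))
  have hmne : ∀ s ∈ Set.Icc a b, ∀ t ∈ Set.Icc a b, s ≤ t → m (s, t) ≠ 0 := by
    intro s hs t ht hst h0
    rcases hst.eq_or_lt with rfl | hlt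
    · rw [hmd, hGz s hs] at h0
      exact hz'0 s hs h0
    · have h := hsec s hs t ht hlt
      rw [h0, mul_zero] at h
      exact hzinj s hs t ht hlt h.symm
  set q : ℝ × ℝ → ℂ := fun w => m (min (π w.1) (π w.2), max (π w.1) (π w.2)) with hq
  have hqc : Continuous q := by
    refine hmc.comp ?_
    fun_prop
  have hq0 : ∀ w, q w ≠ 0 := by
    intro w
    refine hmne _ ?_ _ ?_ min_le_max
    · rcases min_choice (π w.1) (π w.2) with h | h <;> rw [h] <;> exact hπm _
    · rcases max_choice (π w.1) (π w.2) with h | h <;> rw [h] <;> exact hπm _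
  have hqe : ∀ s ∈ Set.Icc a b, ∀ t ∈ Set.Icc a b, s ≤ t → q (s, t) = m (s, t) := by
    intro s hs t ht hst
    simp [hq, hπe s hs, hπe t ht, hst]
  have hqd : ∀ t ∈ Set.Icc a b, q (t, t) = z' t := fun t ht => by
    rw [hqe t ht t ht le_rfl, hmd, hGz t ht]
  have hnd : ∀ t ∈ Set.Icc a b, ‖z' t‖ = v t := by
    intro t ht
    simp [hz', Complex.norm_exp_ofReal_mul_I, abs_of_pos (hv0 t ht)]
  have haI : a ∈ Set.Icc a b := Set.left_mem_Icc.2 hab.le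
  obtain ⟨Θ, hΘc, hΘa, hΘ⟩ := exists_continuous_arg hqc hq0 (a, a) (α := ψ a) (by
    rw [hqd a haI, hnd a haI])
  refine ⟨Θ, hΘc, ?_, ?_⟩
  · have hcov := Circle.isCoveringMap_exp.eqOn_of_comp_eqOn (isPreconnected_Icc (a := a) (b := b))
      (g₁ := fun t => Θ (t, t)) (g₂ := ψ) (by fun_prop) hψ (fun t ht => by
        have h1 := hΘ (t, t)
        rw [hqd t ht, hnd t ht] at h1
        have hvt : (v t : ℂ) ≠ 0 := by exact_mod_cast (hv0 t ht).ne'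
        have h2 := mul_left_cancel₀ hvt h1
        refine Circle.ext ?_
        simpa using h2.symm) haI hΘa
    exact fun t ht => hcov ht
  · intro s hs t ht hst
    refine ⟨(t - s) * ‖q (s, t)‖,
      mul_pos (sub_pos.2 hst) (norm_pos_iff.2 (hq0 _)), ?_⟩
    have h := hsec s hs t ht hst
    rw [← hqe s hs t ht hst.le, hΘ (s, t), Complex.exp_mul_I, ← Complex.ofReal_cos,
      ← Complex.ofReal_sin] at h
    have hre := congrArg Complex.re h
    have him := congrArg Complex.im h
    simp [hz, -Complex.ofReal_cos, -Complex.ofReal_sin] at hre him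
    constructor
    · rw [← hre]; ring
    · rw [← him]; ring

/-! ### Reparametrization by the slope angle -/

namespace Setup

/-- A curve with slope angle `f` and signed speed `w` whose slope angle is a bijective parameter
obeying `σ f' = (g y - P₀) w` gives a solution of the `ψ`-system. -/
theorem exists_solvesPsiSystem (p : Setup) (P₀ : ℝ) {a b : ℝ} {f w x y : ℝ → ℝ}
    (hbij : Set.BijOn f (Set.Icc a b) (Set.Icc p.ψ₂ p.ψ₁))
    (hne : ∀ t ∈ Set.Icc a b, p.g * y t - P₀ ≠ 0) (hw : ∀ t ∈ Set.Icc a b, w t ≠ 0)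
    (hf : ∀ t ∈ Set.Icc a b,
      HasDerivWithinAt f ((p.g * y t - P₀) * w t / p.σ) (Set.Icc a b) t)
    (hx : ∀ t ∈ Set.Icc a b, HasDerivWithinAt x (w t * Real.cos (f t)) (Set.Icc a b) t)
    (hy : ∀ t ∈ Set.Icc a b, HasDerivWithinAt y (w t * Real.sin (f t)) (Set.Icc a b) t)
    {l r : ℝ} (hl : l ∈ Set.Icc a b) (hr : r ∈ Set.Icc a b) (hfl : f l = p.ψ₁) (hfr : f r = p.ψ₂)
    (hL : p.OnLeftWall 0 (x l) (y l)) (hR : p.OnRightWall 0 (x r) (y r)) :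
    ∃ X Y : ℝ → ℝ, (∀ t ∈ Set.Icc a b, X (f t) = x t ∧ Y (f t) = y t) ∧
      p.SolvesPsiSystem P₀ X Y := by
  have hσ := p.σ_pos.ne'
  set τ := Function.invFunOn f (Set.Icc a b)
  have hleft : ∀ t ∈ Set.Icc a b, τ (f t) = t := fun t ht => hbij.injOn.leftInvOn_invFunOn ht
  have hmaps : Set.MapsTo τ (Set.Icc p.ψ₂ p.ψ₁) (Set.Icc a b) := hbij.surjOn.mapsTo_invFunOn
  have hτ : ∀ t ∈ Set.Icc a b, HasDerivWithinAt τ ((p.g * y t - P₀) * w t / p.σ)⁻¹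
      (Set.Icc p.ψ₂ p.ψ₁) (f t) := fun t ht =>
    hasDerivWithinAt_invFunOn (fun u hu => (hf u hu).continuousWithinAt) hbij ht
      (div_ne_zero (mul_ne_zero (hne t ht) (hw t ht)) hσ) (hf t ht)
  have hchain : ∀ {u : ℝ → ℝ} {c t : ℝ}, t ∈ Set.Icc a b →
      HasDerivWithinAt u (w t * c) (Set.Icc a b) t →
      HasDerivWithinAt (fun s => u (τ s)) (p.σ * c / (p.g * y t - P₀))
        (Set.Icc p.ψ₂ p.ψ₁) (f t) := by
    intro u c t ht hu
    rw [← hleft t ht] at hu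
    refine (hu.comp (f t) (hτ t ht) hmaps).congr_deriv ?_
    rw [hleft t ht]
    have h1 := hne t ht
    have h2 := hw t ht
    field_simp
  refine ⟨fun s => x (τ s), fun s => y (τ s), fun t ht => ?_, ?_⟩
  · simp only [hleft t ht, and_self]
  · refine ⟨fun s hs => hne _ (hmaps hs), fun s hs => ?_, fun s hs => ?_, ?_, ?_⟩
    · obtain ⟨t, ht, rfl⟩ := hbij.surjOn hs
      simpa only [hleft t ht] using hchain ht (hx t ht)
    · obtain ⟨t, ht, rfl⟩ := hbij.surjOn hs
      simpa only [hleft t ht] using hchain ht (hy t ht)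
    · simpa only [← hfl, hleft l hl] using hL
    · simpa only [← hfr, hleft r hr] using hR

/-- The chain rule for a curve which, parametrized by its slope angle, solves the
`ψ`-system. -/
theorem deriv_slope_of_solvesPsiSystem (p : Setup) {P₀ a b : ℝ} {X Y : ℝ → ℝ}
    (hXY : p.SolvesPsiSystem P₀ X Y) (hab : a < b) {f x y : ℝ → ℝ}
    (hmaps : Set.MapsTo f (Set.Icc a b) (Set.Icc p.ψ₂ p.ψ₁))
    (hX : ∀ t ∈ Set.Icc a b, X (f t) = x t) (hY : ∀ t ∈ Set.Icc a b, Y (f t) = y t)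
    {t m w : ℝ} (ht : t ∈ Set.Icc a b) (hf : HasDerivWithinAt f m (Set.Icc a b) t)
    (hx : HasDerivWithinAt x (w * Real.cos (f t)) (Set.Icc a b) t)
    (hy : HasDerivWithinAt y (w * Real.sin (f t)) (Set.Icc a b) t) :
    p.σ * m = (p.g * y t - P₀) * w := by
  have hu := uniqueDiffOn_Icc hab t ht
  have hne := hXY.ne_zero _ (hmaps ht)
  have hx' := ((hXY.deriv_X _ (hmaps ht)).comp t hf hmaps).congr_of_mem
    (fun s hs => (hX s hs).symm) ht
  have hy' := ((hXY.deriv_Y _ (hmaps ht)).comp t hf hmaps).congr_of_mem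
    (fun s hs => (hY s hs).symm) ht
  have ex := hu.eq_deriv _ hx hx'
  have ey := hu.eq_deriv _ hy hy'
  rw [hY t ht] at hne ex ey
  have hw : w = p.σ * m / (p.g * y t - P₀) := by
    calc w = w * (Real.sin (f t) ^ 2 + Real.cos (f t) ^ 2) := by
          rw [Real.sin_sq_add_cos_sq, mul_one]
      _ = w * Real.sin (f t) * Real.sin (f t) + w * Real.cos (f t) * Real.cos (f t) := by ring
      _ = p.σ * m / (p.g * y t - P₀) * (Real.sin (f t) ^ 2 + Real.cos (f t) ^ 2) := by
          rw [ex, ey]; ring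
      _ = _ := by rw [Real.sin_sq_add_cos_sq, mul_one]
  rw [hw]
  field_simp

theorem γ_le (p : Setup) : p.γ ≤ Real.pi / 2 := Real.arcsin_le_pi_div_two _

theorem sin_γ (p : Setup) : Real.sin p.γ = -(p.jump / p.σ) :=
  Real.sin_arcsin (by linarith [p.le_one]) (by linarith [p.neg_one_le])

/-! ### Free surfaces -/

/-- Every point of a piecewise polar curve has polar coordinates in the closed vessel, away from
the corner. -/
theorem IsPiecewisePolar.exists_polar {p : Setup} {h a b : ℝ} {x y : ℝ → ℝ}
    (hp : p.IsPiecewisePolar h a b x y) (hab : a < b) {t : ℝ} (ht : t ∈ Set.Icc a b) :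
    ∃ r φ : ℝ, 0 < r ∧ φ ∈ Set.Icc p.θ₂ (Real.pi - p.θ₁) ∧
      x t = r * Real.cos φ ∧ y t = h + r * Real.sin φ := by
  obtain ⟨n, τ, h0, hn, hτ⟩ := hp
  have hex : ∃ i < n, t ∈ Set.Icc (τ i) (τ (i + 1)) := by
    by_contra! hcon
    have hlt : ∀ i ≤ n, 0 < i → τ i < t := by
      intro i
      induction i with
      | zero => intro _ h; exact absurd h (lt_irrefl 0)
      | succ i ih =>
        intro hi _
        by_contra! hle
        refine hcon i hi ⟨?_, hle⟩
        rcases Nat.eq_zero_or_pos i with rfl | hpos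
        · rw [h0]; exact ht.1
        · exact (ih (Nat.le_of_succ_le hi) hpos).le
    rcases Nat.eq_zero_or_pos n with rfl | hpos
    · linarith
    · have := hlt n le_rfl hpos
      linarith [ht.2]
  obtain ⟨i, hi, hti⟩ := hex
  obtain ⟨-, ρ, φ, -, -, hφ⟩ := hτ i hi
  obtain ⟨h1, h2, h3, h4⟩ := hφ t hti
  exact ⟨ρ (φ t), φ t, h2, h1, h3, h4⟩

namespace IsFreeSurface

variable {p : Setup} {P₀ a b : ℝ} {x y ψ : ℝ → ℝ}

theorem hasDeriv_x (h : p.IsFreeSurface P₀ a b x y ψ) {t : ℝ} (ht : t ∈ Set.Icc a b) :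
    HasDerivWithinAt x (curveSpeed a b x y t * Real.cos (ψ t)) (Set.Icc a b) t := by
  rw [← h.slope.cos_eq t ht]
  exact (h.contDiffOn_x.differentiableOn (by norm_num) t ht).hasDerivWithinAt

theorem hasDeriv_y (h : p.IsFreeSurface P₀ a b x y ψ) {t : ℝ} (ht : t ∈ Set.Icc a b) :
    HasDerivWithinAt y (curveSpeed a b x y t * Real.sin (ψ t)) (Set.Icc a b) t := by
  rw [← h.slope.sin_eq t ht]
  exact (h.contDiffOn_y.differentiableOn (by norm_num) t ht).hasDerivWithinAt

theorem differentiableOn_deriv (h : p.IsFreeSurface P₀ a b x y ψ) :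
    DifferentiableOn ℝ (derivWithin x (Set.Icc a b)) (Set.Icc a b) ∧
      DifferentiableOn ℝ (derivWithin y (Set.Icc a b)) (Set.Icc a b) :=
  ⟨(h.contDiffOn_x.derivWithin (uniqueDiffOn_Icc h.lt) (m := 1) (by norm_num)).differentiableOn
      (by norm_num),
    (h.contDiffOn_y.derivWithin (uniqueDiffOn_Icc h.lt) (m := 1) (by norm_num)).differentiableOn
      (by norm_num)⟩

theorem differentiableOn_speed (h : p.IsFreeSurface P₀ a b x y ψ) :
    DifferentiableOn ℝ (curveSpeed a b x y) (Set.Icc a b) := by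
  intro t ht
  have hpos := Real.sqrt_pos.1 (h.regular t ht)
  exact (((h.differentiableOn_deriv.1 t ht).pow 2).add
    ((h.differentiableOn_deriv.2 t ht).pow 2)).sqrt hpos.ne'

/-- The slope angle of a `C²` curve is differentiable. -/
theorem differentiableOn_slope (h : p.IsFreeSurface P₀ a b x y ψ) :
    DifferentiableOn ℝ ψ (Set.Icc a b) := by
  intro t ht
  have hv := h.differentiableOn_speed t ht
  have hv0 := (h.regular t ht).ne'
  refine differentiableWithinAt_angle (h.slope.continuousOn t ht) ?_ ?_
  · have he : ∀ s ∈ Set.Icc a b, _ := fun s hs => (eq_div_of_mul_eq (h.regular s hs).ne'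
      ((mul_comm _ _).trans (h.slope.cos_eq s hs).symm))
    exact ((h.differentiableOn_deriv.1 t ht).div hv hv0).congr he (he t ht)
  · have he : ∀ s ∈ Set.Icc a b, _ := fun s hs => (eq_div_of_mul_eq (h.regular s hs).ne'
      ((mul_comm _ _).trans (h.slope.sin_eq s hs).symm))
    exact ((h.differentiableOn_deriv.2 t ht).div hv hv0).congr he (he t ht)

/-- The slope angle at the right wall has no additional full turns. The angle `Θ (s, t)` of the
secants joins `ψ a = Θ (a, a)` to `ψ b = Θ (b, b)` through the direction `Θ (a, b)` of the chord.
All points lie on one side of the left wall, so the secants from the left end point have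
`Θ (a, ·)` in the half turn `(-θ₁, π - θ₁]`; likewise the right wall confines `Θ (·, b)` to the
half turn `[θ₂ - π, θ₂)`, up to the multiple `2πk` by which `ψ b` differs from `ψ₂`. The two half
turns meet in `Θ (a, b)` only for `k = 0`. -/
theorem slope_right_eq (h : p.IsFreeSurface P₀ a b x y ψ) (hψ₁ : 0 < p.ψ₁) : ψ b = p.ψ₂ := by
  obtain ⟨Θ, hΘc, hΘd, hΘ⟩ := exists_secant_angle h.lt h.differentiableOn_speed.continuousOn
    h.regular h.slope.continuousOn (fun t ht => h.hasDeriv_x ht) (fun t ht => h.hasDeriv_y ht)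
    h.simple
  obtain ⟨k, hk⟩ := h.slope_right
  have hpi := Real.pi_pos
  have hγ := p.γ_le
  have hθ₁ := p.θ₁_pos
  have hθ₂ := p.θ₂_pos
  have hsum := p.angle_sum_lt
  have hα : 0 < p.γ + Real.pi / 2 := by unfold ψ₁ at hψ₁; linarith
  have ha : a ∈ Set.Icc a b := Set.left_mem_Icc.2 h.lt.le
  have hb : b ∈ Set.Icc a b := Set.right_mem_Icc.2 h.lt.le
  have hA : ∃ rA : ℝ, x a = rA * Real.cos (Real.pi - p.θ₁) ∧
      y a = -P₀ / p.g + rA * Real.sin (Real.pi - p.θ₁) := by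
    obtain ⟨r, -, h1, h2⟩ := (h.left_wall a ha).2 rfl
    exact ⟨r, h1, h2⟩
  have hB : ∃ rB : ℝ, x b = rB * Real.cos p.θ₂ ∧ y b = -P₀ / p.g + rB * Real.sin p.θ₂ := by
    obtain ⟨r, -, h1, h2⟩ := (h.right_wall b hb).2 rfl
    exact ⟨r, h1, h2⟩
  obtain ⟨rA, hxA, hyA⟩ := hA
  obtain ⟨rB, hxB, hyB⟩ := hB
  have hleft : Θ (a, b) - (Real.pi - p.θ₁) ∈ Set.Ioo (-Real.pi) 0 := by
    refine mem_Ioo_of_sin_neg (h := fun t => Θ (a, t) - (Real.pi - p.θ₁))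
      (isPreconnected_Icc (a := a) (b := b)) (by fun_prop) ha ?_ ?_ hb h.lt.ne'
    · simp only [hΘd a ha, h.slope_left, ψ₁]
      constructor <;> linarith
    · intro t ht hta
      obtain ⟨r, hr, hx, hy⟩ := hΘ a ha t ht (lt_of_le_of_ne ht.1 (Ne.symm hta))
      obtain ⟨s, φ, hs, hφ, hxt, hyt⟩ := h.polar.exists_polar h.lt ht
      have hφlt : φ < Real.pi - p.θ₁ := by
        refine lt_of_le_of_ne hφ.2 fun he => hta ((h.left_wall t ht).1 ?_)
        exact ⟨s, hs.le, by rw [hxt, he], by rw [hyt, he]⟩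
      have hsin : Real.sin (φ - (Real.pi - p.θ₁)) < 0 :=
        Real.sin_neg_of_neg_of_neg_pi_lt (by linarith) (by linarith [hφ.1])
      -- The cross product of the wall direction with the secant, in two ways.
      have hcross : r * Real.sin (Θ (a, t) - (Real.pi - p.θ₁))
          = s * Real.sin (φ - (Real.pi - p.θ₁)) := by
        rw [Real.sin_sub (Θ (a, t)), Real.sin_sub φ]
        calc _ = r * Real.sin (Θ (a, t)) * Real.cos (Real.pi - p.θ₁)
              - r * Real.cos (Θ (a, t)) * Real.sin (Real.pi - p.θ₁) := by ring
          _ = _ := by rw [← hx, ← hy, hxt, hyt, hxA, hyA]; ring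
      have hneg := mul_neg_of_pos_of_neg hs hsin
      rw [← hcross] at hneg
      exact neg_of_mul_neg_right hneg hr.le
  have hright : -Real.pi - (Θ (a, b) - p.θ₂ - 2 * Real.pi * k) ∈ Set.Ioo (-Real.pi) 0 := by
    refine mem_Ioo_of_sin_neg (h := fun t => -Real.pi - (Θ (t, b) - p.θ₂ - 2 * Real.pi * k))
      (isPreconnected_Icc (a := a) (b := b)) (by fun_prop) hb ?_ ?_ ha h.lt.ne
    · simp only [hΘd b hb, hk, ψ₂]
      constructor <;> linarith
    · intro t ht htb
      obtain ⟨r, hr, hx, hy⟩ := hΘ t ht b hb (lt_of_le_of_ne ht.2 htb)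
      obtain ⟨s, φ, hs, hφ, hxt, hyt⟩ := h.polar.exists_polar h.lt ht
      have hφlt : p.θ₂ < φ := by
        refine lt_of_le_of_ne hφ.1 fun he => htb ((h.right_wall t ht).1 ?_)
        exact ⟨s, hs.le, by rw [hxt, he], by rw [hyt, he]⟩
      have hsin : 0 < Real.sin (φ - p.θ₂) :=
        Real.sin_pos_of_pos_of_lt_pi (by linarith) (by linarith [hφ.2])
      have hper : Real.sin (-Real.pi - (Θ (t, b) - p.θ₂ - 2 * Real.pi * k))
          = Real.sin (Θ (t, b) - p.θ₂) := by
        have he : -Real.pi - (Θ (t, b) - p.θ₂ - 2 * Real.pi * k)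
            = -(Θ (t, b) - p.θ₂ + Real.pi) + k * (2 * Real.pi) := by ring
        rw [he, Real.sin_add_int_mul_two_pi, Real.sin_neg, Real.sin_add_pi, neg_neg]
      have hcross : r * Real.sin (Θ (t, b) - p.θ₂) = -(s * Real.sin (φ - p.θ₂)) := by
        rw [Real.sin_sub, Real.sin_sub]
        calc _ = r * Real.sin (Θ (t, b)) * Real.cos p.θ₂
              - r * Real.cos (Θ (t, b)) * Real.sin p.θ₂ := by ring
          _ = _ := by rw [← hx, ← hy, hxt, hyt, hxB, hyB]; ring
      have hneg := neg_neg_of_pos (mul_pos hs hsin)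
      rw [← hcross] at hneg
      rw [hper]
      exact neg_of_mul_neg_right hneg hr.le
  have hk0 : k = 0 := by
    have h1 : (k : ℝ) < 1 := by
      by_contra! hle
      nlinarith [hleft.1, hleft.2, hright.1, hright.2]
    have h2 : (-1 : ℝ) < k := by
      by_contra! hle
      nlinarith [hleft.1, hleft.2, hright.1, hright.2]
    have h1' : k < 1 := by exact_mod_cast h1
    have h2' : -1 < k := by exact_mod_cast h2
    omega
  rw [hk, hk0]
  simp

/-- The shifted Euler-Lagrange system says that the curvature is `g y / σ`. -/
theorem hasDeriv_slope (h : p.IsFreeSurface P₀ a b x y ψ) (hEL : p.SolvesShiftedEL a b x y ψ)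
    {t : ℝ} (ht : t ∈ Set.Icc a b) :
    HasDerivWithinAt ψ (p.g / p.σ * y t * curveSpeed a b x y t) (Set.Icc a b) t := by
  obtain ⟨m, hm, h1, h2⟩ := hEL t ht
  rw [h.slope.cos_eq t ht] at h1
  rw [h.slope.sin_eq t ht] at h2
  refine hm.congr_deriv ?_
  have hσ := p.σ_pos.ne'
  have hs := Real.sin_sq_add_cos_sq (ψ t)
  field_simp
  linear_combination (p.g * y t * curveSpeed a b x y t - p.σ * m) * hs
    - Real.cos (ψ t) * h1 - Real.sin (ψ t) * h2

theorem height_neg (h : p.IsFreeSurface P₀ a b x y ψ) (hEL : p.SolvesShiftedEL a b x y ψ)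
    (hψ₁ : 0 < p.ψ₁) (hψ₂ : p.ψ₂ < 0) : ∀ t ∈ Set.Icc a b, y t < 0 :=
  pendulum_height_neg h.lt (div_pos p.g_pos p.σ_pos) h.differentiableOn_speed.continuousOn
    h.regular (fun _ ht => h.hasDeriv_slope hEL ht) (fun _ ht => h.hasDeriv_y ht)
    (by rwa [h.slope_left]) (by rwa [h.slope_right_eq hψ₁])

theorem strictAntiOn_slope (h : p.IsFreeSurface P₀ a b x y ψ)
    (hEL : p.SolvesShiftedEL a b x y ψ) (hψ₁ : 0 < p.ψ₁) (hψ₂ : p.ψ₂ < 0) :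
    StrictAntiOn ψ (Set.Icc a b) :=
  pendulum_strictAntiOn h.lt (div_pos p.g_pos p.σ_pos) h.differentiableOn_speed.continuousOn
    h.regular (fun _ ht => h.hasDeriv_slope hEL ht) (fun _ ht => h.hasDeriv_y ht)
    (by rwa [h.slope_left]) (by rwa [h.slope_right_eq hψ₁])

theorem bijOn_slope (h : p.IsFreeSurface P₀ a b x y ψ)
    (hEL : p.SolvesShiftedEL a b x y ψ) (hψ₁ : 0 < p.ψ₁) (hψ₂ : p.ψ₂ < 0) :
    Set.BijOn ψ (Set.Icc a b) (Set.Icc p.ψ₂ p.ψ₁) := by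
  have hbij := bijOn_Icc_of_strictAntiOn h.lt.le h.slope.continuousOn
    (h.strictAntiOn_slope hEL hψ₁ hψ₂)
  rwa [h.slope_right_eq hψ₁, h.slope_left] at hbij

/-- The height increases as long as `ψ > 0` and decreases once `ψ < 0`. -/
theorem exists_unique_max (h : p.IsFreeSurface P₀ a b x y ψ)
    (hEL : p.SolvesShiftedEL a b x y ψ) (hψ₁ : 0 < p.ψ₁) (hψ₂ : p.ψ₂ < 0) :
    ∃ tm ∈ Set.Icc a b, y tm < 0 ∧ ∀ t ∈ Set.Icc a b, t ≠ tm → y t < y tm := by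
  have hanti := h.strictAntiOn_slope hEL hψ₁ hψ₂
  have hbij := h.bijOn_slope hEL hψ₁ hψ₂
  have hpi : ∀ t ∈ Set.Icc a b, ψ t ∈ Set.Ioo (-Real.pi) Real.pi := by
    intro t ht
    have h1 := hbij.mapsTo ht
    have hγ := p.γ_le
    have hθ₁ := p.θ₁_pos
    have hθ₂ := p.θ₂_pos
    unfold ψ₁ ψ₂ at h1
    exact ⟨by linarith [h1.1], by linarith [h1.2]⟩
  obtain ⟨c, hc, hc0⟩ := hbij.surjOn (show (0 : ℝ) ∈ Set.Icc p.ψ₂ p.ψ₁ from ⟨hψ₂.le, hψ₁.le⟩)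
  have hyc : ContinuousOn y (Set.Icc a b) := fun t ht => (h.hasDeriv_y ht).continuousWithinAt
  refine ⟨c, hc, h.height_neg hEL hψ₁ hψ₂ c hc, fun t ht htc => ?_⟩
  rcases lt_or_gt_of_ne htc with hlt | hgt
  · have hsub : Set.Icc a c ⊆ Set.Icc a b := Set.Icc_subset_Icc_right hc.2
    refine strictMonoOn_of_hasDerivWithinAt_pos (convex_Icc a c) (hyc.mono hsub)
      (fun s hs => (h.hasDeriv_y (hsub (interior_subset hs))).mono
        (interior_subset.trans hsub)) (fun s hs => ?_)
      ⟨ht.1, hlt.le⟩ (Set.right_mem_Icc.2 hc.1) hlt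
    have hs' := hsub (interior_subset hs)
    rw [interior_Icc] at hs
    have hpos := hanti hs' hc hs.2
    rw [hc0] at hpos
    exact mul_pos (h.regular s hs') (Real.sin_pos_of_pos_of_lt_pi hpos (hpi s hs').2)
  · have hsub : Set.Icc c b ⊆ Set.Icc a b := Set.Icc_subset_Icc_left hc.1
    refine strictAntiOn_of_hasDerivWithinAt_neg (convex_Icc c b) (hyc.mono hsub)
      (fun s hs => (h.hasDeriv_y (hsub (interior_subset hs))).mono
        (interior_subset.trans hsub)) (fun s hs => ?_)
      (Set.left_mem_Icc.2 hc.2) ⟨hgt.le, ht.2⟩ hgt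
    have hs' := hsub (interior_subset hs)
    rw [interior_Icc] at hs
    have hneg := hanti hc hs' hs.1
    rw [hc0] at hneg
    exact mul_neg_of_pos_of_neg (h.regular s hs')
      (Real.sin_neg_of_neg_of_neg_pi_lt hneg (hpi s hs').1)

theorem solvesShiftedEL_iff (h : p.IsFreeSurface P₀ a b x y ψ)
    (hψ₁ : 0 < p.ψ₁) (hψ₂ : p.ψ₂ < 0) :
    p.SolvesShiftedEL a b x y ψ ↔ p.SolvesViaSlopeAngle P₀ a b x y ψ := by
  have hg := p.g_pos.ne'
  have hσ := p.σ_pos.ne'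
  have hshift : ∀ t, p.g * (y t + P₀ / p.g) - P₀ = p.g * y t := fun t => by field_simp; ring
  have hyd : ∀ t ∈ Set.Icc a b, HasDerivWithinAt (fun s => y s + P₀ / p.g)
      (curveSpeed a b x y t * Real.sin (ψ t)) (Set.Icc a b) t := fun t ht =>
    (h.hasDeriv_y ht).add_const _
  have ha : a ∈ Set.Icc a b := Set.left_mem_Icc.2 h.lt.le
  have hb : b ∈ Set.Icc a b := Set.right_mem_Icc.2 h.lt.le
  constructor
  · intro hEL
    have hbij := h.bijOn_slope hEL hψ₁ hψ₂
    refine ⟨hbij, p.exists_solvesPsiSystem P₀ (w := curveSpeed a b x y) hbij ?_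
      (fun t ht => (h.regular t ht).ne') ?_ (fun t ht => h.hasDeriv_x ht) hyd ha hb
      h.slope_left (h.slope_right_eq hψ₁) ?_ ?_⟩
    · intro t ht
      rw [hshift]
      exact mul_ne_zero hg (h.height_neg hEL hψ₁ hψ₂ t ht).ne
    · intro t ht
      refine (h.hasDeriv_slope hEL ht).congr_deriv ?_
      rw [hshift]
      ring
    · obtain ⟨r, hr, h1, h2⟩ := (h.left_wall a ha).2 rfl
      exact ⟨r, hr, h1, by rw [h2]; ring⟩
    · obtain ⟨r, hr, h1, h2⟩ := (h.right_wall b hb).2 rfl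
      exact ⟨r, hr, h1, by rw [h2]; ring⟩
  · rintro ⟨hbij, X, Y, hXY, hsys⟩ t ht
    have hd := (h.differentiableOn_slope t ht).hasDerivWithinAt
    have hm := p.deriv_slope_of_solvesPsiSystem hsys h.lt hbij.mapsTo
      (fun s hs => (hXY s hs).1) (y := fun s => y s + P₀ / p.g) (fun s hs => (hXY s hs).2) ht hd
      (h.hasDeriv_x ht) (hyd t ht)
    rw [hshift] at hm
    refine ⟨_, hd, ?_, ?_⟩
    · rw [h.slope.cos_eq t ht]
      linear_combination (-Real.cos (ψ t)) * hm
    · rw [h.slope.sin_eq t ht]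
      linear_combination (-Real.sin (ψ t)) * hm

end IsFreeSurface

end Setup

/-! ### Polar graphs -/

namespace Setup

variable {p : Setup} {P₀ : ℝ} {ρ ψ : ℝ → ℝ}

theorem angleRange_lt (p : Setup) : p.θ₂ < Real.pi - p.θ₁ := by linarith [p.angle_sum_lt]

theorem hasDeriv_polar (hρ : ContDiffOn ℝ 2 ρ p.angleRange) {θ : ℝ} (hθ : θ ∈ p.angleRange) :
    HasDerivWithinAt ρ (p.polarDeriv ρ θ) p.angleRange θ :=
  (hρ.differentiableOn (by norm_num) θ hθ).hasDerivWithinAt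

theorem differentiableOn_polarDeriv (hρ : ContDiffOn ℝ 2 ρ p.angleRange) :
    DifferentiableOn ℝ (p.polarDeriv ρ) p.angleRange :=
  (hρ.derivWithin (uniqueDiffOn_Icc p.angleRange_lt) (m := 1) (by norm_num)).differentiableOn
    (by norm_num)

theorem polarSpeed_pos {θ : ℝ} (h0 : 0 < ρ θ) : 0 < p.polarSpeed ρ θ :=
  Real.sqrt_pos.2 (by positivity)

theorem polarSpeed_sq {θ : ℝ} : p.polarSpeed ρ θ ^ 2 = ρ θ ^ 2 + p.polarDeriv ρ θ ^ 2 :=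
  Real.sq_sqrt (by positivity)

theorem differentiableOn_polarSpeed (hρ : ContDiffOn ℝ 2 ρ p.angleRange)
    (h0 : ∀ θ ∈ p.angleRange, 0 < ρ θ) :
    DifferentiableOn ℝ (p.polarSpeed ρ) p.angleRange := by
  intro θ hθ
  have hpos : 0 < ρ θ ^ 2 + p.polarDeriv ρ θ ^ 2 := by have := h0 θ hθ; positivity
  exact (((hasDeriv_polar hρ hθ).differentiableWithinAt.pow 2).add
    ((differentiableOn_polarDeriv hρ θ hθ).pow 2)).sqrt hpos.ne'

namespace IsPolarSlopeAngle

theorem differentiableOn (h : p.IsPolarSlopeAngle ρ ψ) (hρ : ContDiffOn ℝ 2 ρ p.angleRange)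
    (h0 : ∀ θ ∈ p.angleRange, 0 < ρ θ) : DifferentiableOn ℝ ψ p.angleRange := by
  intro θ hθ
  have hr := (hasDeriv_polar hρ hθ).differentiableWithinAt
  have hr' := differentiableOn_polarDeriv hρ θ hθ
  have hS := differentiableOn_polarSpeed hρ h0 θ hθ
  have hS0 := (polarSpeed_pos (p := p) (h0 θ hθ)).ne'
  have hsin : DifferentiableWithinAt ℝ Real.sin p.angleRange θ :=
    Real.differentiableAt_sin.differentiableWithinAt
  have hcos : DifferentiableWithinAt ℝ Real.cos p.angleRange θ :=
    Real.differentiableAt_cos.differentiableWithinAt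
  refine differentiableWithinAt_angle (h.continuousOn θ hθ) ?_ ?_
  · exact (((hr.mul hsin).sub (hr'.mul hcos)).div hS hS0).congr
      (fun s hs => h.cos_eq s hs) (h.cos_eq θ hθ)
  · exact (((hr'.mul hsin).add (hr.mul hcos)).neg.div hS hS0).congr
      (fun s hs => h.sin_eq s hs) (h.sin_eq θ hθ)

/-- The angle `θ - ψ - π / 2` between the graph and the circle about the corner has sine
`ρ' / √(ρ² + ρ'²)`. -/
theorem polarDeriv_div (h : p.IsPolarSlopeAngle ρ ψ) {θ : ℝ} (hθ : θ ∈ p.angleRange) :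
    p.polarDeriv ρ θ / p.polarSpeed ρ θ = -Real.cos (θ - ψ θ) := by
  rw [Real.cos_sub, h.cos_eq θ hθ, h.sin_eq θ hθ]
  linear_combination (-(p.polarDeriv ρ θ / p.polarSpeed ρ θ)) * Real.sin_sq_add_cos_sq θ

theorem div_polarSpeed (h : p.IsPolarSlopeAngle ρ ψ) {θ : ℝ} (hθ : θ ∈ p.angleRange) :
    ρ θ / p.polarSpeed ρ θ = Real.sin (θ - ψ θ) := by
  rw [Real.sin_sub, h.cos_eq θ hθ, h.sin_eq θ hθ]
  linear_combination (-(ρ θ / p.polarSpeed ρ θ)) * Real.sin_sq_add_cos_sq θ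

/-- The signed speed is negative: the slope angle belongs to the opposite orientation. -/
theorem hasDeriv_x (h : p.IsPolarSlopeAngle ρ ψ) (hρ : ContDiffOn ℝ 2 ρ p.angleRange)
    (h0 : ∀ θ ∈ p.angleRange, 0 < ρ θ) {θ : ℝ} (hθ : θ ∈ p.angleRange) :
    HasDerivWithinAt (fun s => ρ s * Real.cos s) (-p.polarSpeed ρ θ * Real.cos (ψ θ))
      p.angleRange θ := by
  refine ((hasDeriv_polar hρ hθ).mul (Real.hasDerivAt_cos θ).hasDerivWithinAt).congr_deriv ?_
  have hS0 := (polarSpeed_pos (p := p) (h0 θ hθ)).ne'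
  rw [h.cos_eq θ hθ]
  field_simp
  ring

theorem hasDeriv_y (h : p.IsPolarSlopeAngle ρ ψ) (hρ : ContDiffOn ℝ 2 ρ p.angleRange)
    (h0 : ∀ θ ∈ p.angleRange, 0 < ρ θ) {θ : ℝ} (hθ : θ ∈ p.angleRange) :
    HasDerivWithinAt (fun s => ρ s * Real.sin s) (-p.polarSpeed ρ θ * Real.sin (ψ θ))
      p.angleRange θ := by
  refine ((hasDeriv_polar hρ hθ).mul (Real.hasDerivAt_sin θ).hasDerivWithinAt).congr_deriv ?_
  have hS0 := (polarSpeed_pos (p := p) (h0 θ hθ)).ne'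
  rw [h.sin_eq θ hθ]
  field_simp

/-- In terms of the slope angle the polar Euler-Lagrange equation prescribes the curvature. -/
theorem equation_iff (h : p.IsPolarSlopeAngle ρ ψ) (h0 : ∀ θ ∈ p.angleRange, 0 < ρ θ)
    {θ m : ℝ} (hθ : θ ∈ p.angleRange) (hm : HasDerivWithinAt ψ m p.angleRange θ) :
    p.g * ρ θ ^ 2 * Real.sin θ + p.σ * (ρ θ / p.polarSpeed ρ θ)
      - p.σ * derivWithin (fun s => p.polarDeriv ρ s / p.polarSpeed ρ s) p.angleRange θ
      - P₀ * ρ θ = 0 ↔ p.σ * m = (p.g * (ρ θ * Real.sin θ) - P₀) * -p.polarSpeed ρ θ := by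
  have hd : HasDerivWithinAt (fun s => p.polarDeriv ρ s / p.polarSpeed ρ s)
      (ρ θ / p.polarSpeed ρ θ * (1 - m)) p.angleRange θ := by
    have h1 := (((hasDerivWithinAt_id θ p.angleRange).sub hm).cos).neg
    refine (h1.congr_deriv ?_).congr_of_mem (fun s hs => h.polarDeriv_div hs) hθ
    rw [h.div_polarSpeed hθ]
    simp
  rw [hd.derivWithin (uniqueDiffOn_Icc p.angleRange_lt θ hθ)]
  have hS0 := (polarSpeed_pos (p := p) (h0 θ hθ)).ne'
  have hρ0 := (h0 θ hθ).ne'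
  rw [show p.g * ρ θ ^ 2 * Real.sin θ + p.σ * (ρ θ / p.polarSpeed ρ θ)
      - p.σ * (ρ θ / p.polarSpeed ρ θ * (1 - m)) - P₀ * ρ θ
      = ρ θ / p.polarSpeed ρ θ *
        (p.σ * m - (p.g * (ρ θ * Real.sin θ) - P₀) * -p.polarSpeed ρ θ) by field_simp; ring,
    mul_eq_zero, or_iff_right (div_ne_zero hρ0 hS0), sub_eq_zero]

end IsPolarSlopeAngle

/-- The slope angle of a polar graph is `θ - π / 2`, the slope angle of the circle about the
corner, less the angle between the graph and that circle. -/
theorem isPolarSlopeAngle_arcsin (hρ : ContDiffOn ℝ 2 ρ p.angleRange)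
    (h0 : ∀ θ ∈ p.angleRange, 0 < ρ θ) :
    p.IsPolarSlopeAngle ρ
      (fun θ => θ - Real.arcsin (p.polarDeriv ρ θ / p.polarSpeed ρ θ) - Real.pi / 2) := by
  have hq : ContinuousOn (fun θ => p.polarDeriv ρ θ / p.polarSpeed ρ θ) p.angleRange :=
    (differentiableOn_polarDeriv hρ).continuousOn.div
      (differentiableOn_polarSpeed hρ h0).continuousOn
      (fun θ hθ => (polarSpeed_pos (h0 θ hθ)).ne')
  have key : ∀ θ ∈ p.angleRange,
      Real.sin (Real.arcsin (p.polarDeriv ρ θ / p.polarSpeed ρ θ))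
        = p.polarDeriv ρ θ / p.polarSpeed ρ θ ∧
      Real.cos (Real.arcsin (p.polarDeriv ρ θ / p.polarSpeed ρ θ)) = ρ θ / p.polarSpeed ρ θ := by
    intro θ hθ
    have hS := polarSpeed_pos (p := p) (h0 θ hθ)
    have hsq := polarSpeed_sq (p := p) (ρ := ρ) (θ := θ)
    have hle : |p.polarDeriv ρ θ| ≤ p.polarSpeed ρ θ :=
      abs_le_of_sq_le_sq (by nlinarith [sq_nonneg (ρ θ)]) hS.le
    have hle' : |p.polarDeriv ρ θ / p.polarSpeed ρ θ| ≤ 1 := by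
      rw [abs_div, abs_of_pos hS]
      exact div_le_one_of_le₀ hle hS.le
    refine ⟨Real.sin_arcsin (abs_le.1 hle').1 (abs_le.1 hle').2, ?_⟩
    rw [Real.cos_arcsin]
    have he : 1 - (p.polarDeriv ρ θ / p.polarSpeed ρ θ) ^ 2 = (ρ θ / p.polarSpeed ρ θ) ^ 2 := by
      field_simp
      linarith
    rw [he, Real.sqrt_sq (div_pos (h0 θ hθ) hS).le]
  refine ⟨?_, fun θ hθ => ?_, fun θ hθ => ?_⟩
  · exact (continuousOn_id.sub (Real.continuous_arcsin.comp_continuousOn hq)).sub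
      continuousOn_const
  · rw [Real.cos_sub_pi_div_two, Real.sin_sub, (key θ hθ).1, (key θ hθ).2]
    ring
  · rw [Real.sin_sub_pi_div_two, Real.cos_sub, (key θ hθ).1, (key θ hθ).2]
    ring

theorem solvesPolarEL_iff (hψ₁ : 0 < p.ψ₁) (hψ₂ : p.ψ₂ < 0)
    (hρ : ContDiffOn ℝ 2 ρ p.angleRange) (h0 : ∀ θ ∈ p.angleRange, 0 < ρ θ) :
    p.SolvesPolarEL P₀ ρ ↔ p.PolarSolvesViaSlopeAngle P₀ ρ := by
  have hlt := p.angleRange_lt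
  have hg := p.g_pos.ne'
  have hσ := p.σ_pos.ne'
  have hr : p.θ₂ ∈ p.angleRange := Set.left_mem_Icc.2 hlt.le
  have hl : Real.pi - p.θ₁ ∈ p.angleRange := Set.right_mem_Icc.2 hlt.le
  constructor
  · intro hEL
    set ψ : ℝ → ℝ :=
      fun θ => θ - Real.arcsin (p.polarDeriv ρ θ / p.polarSpeed ρ θ) - Real.pi / 2 with hψ
    have hs : p.IsPolarSlopeAngle ρ ψ := isPolarSlopeAngle_arcsin hρ h0
    have hψl : ψ (Real.pi - p.θ₁) = p.ψ₁ := by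
      simp only [hψ, hEL.left_contact, ψ₁, γ, Real.arcsin_neg]
      ring
    have hψr : ψ p.θ₂ = p.ψ₂ := by
      simp only [hψ, hEL.right_contact, ψ₂, γ]
      ring
    have hd : ∀ θ ∈ p.angleRange, HasDerivWithinAt ψ
        ((p.g * (ρ θ * Real.sin θ) - P₀) * -p.polarSpeed ρ θ / p.σ) p.angleRange θ := by
      intro θ hθ
      have h1 := (hs.differentiableOn hρ h0 θ hθ).hasDerivWithinAt
      refine h1.congr_deriv ?_
      rw [eq_div_iff hσ, mul_comm]
      exact (hs.equation_iff h0 hθ h1).1 (hEL.equation θ hθ)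
    -- Reflected in the vertical axis, the graph is traversed from left to right: `-ψ` is its
    -- slope angle, and it solves the pendulum equation with the shifted height.
    have hψ' : ∀ θ ∈ p.angleRange, HasDerivWithinAt (fun s => -ψ s)
        (p.g / p.σ * (ρ θ * Real.sin θ - P₀ / p.g) * p.polarSpeed ρ θ) p.angleRange θ := by
      intro θ hθ
      refine (hd θ hθ).neg.congr_deriv ?_
      field_simp
    have hy' : ∀ θ ∈ p.angleRange, HasDerivWithinAt (fun s => ρ s * Real.sin s - P₀ / p.g)
        (p.polarSpeed ρ θ * Real.sin (-ψ θ)) p.angleRange θ := by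
      intro θ hθ
      refine ((hs.hasDeriv_y hρ h0 hθ).sub_const _).congr_deriv ?_
      rw [Real.sin_neg]
      ring
    have hva : 0 < -ψ p.θ₂ := by rw [hψr]; linarith
    have hvb : -ψ (Real.pi - p.θ₁) < 0 := by rw [hψl]; linarith
    have hκ := div_pos p.g_pos p.σ_pos
    have hSc := (differentiableOn_polarSpeed hρ h0).continuousOn
    have hneg := pendulum_height_neg hlt hκ hSc (fun θ hθ => polarSpeed_pos (h0 θ hθ))
      hψ' hy' hva hvb
    have hanti := pendulum_strictAntiOn hlt hκ hSc (fun θ hθ => polarSpeed_pos (h0 θ hθ))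
      hψ' hy' hva hvb
    have hbij : Set.BijOn ψ p.angleRange (Set.Icc p.ψ₂ p.ψ₁) := by
      have hmono : StrictMonoOn ψ p.angleRange := fun s hs t ht hst => by
        simpa using hanti hs ht hst
      rw [← hψr, ← hψl]
      exact ⟨fun θ hθ => ⟨hmono.monotoneOn hr hθ hθ.1, hmono.monotoneOn hθ hl hθ.2⟩,
        hmono.injOn, intermediate_value_Icc hlt.le hs.continuousOn⟩
    refine ⟨ψ, hs, hψl, hψr, hbij, p.exists_solvesPsiSystem P₀
      (w := fun θ => -p.polarSpeed ρ θ) hbij (fun θ hθ => ?_)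
      (fun θ hθ => (neg_neg_of_pos (polarSpeed_pos (h0 θ hθ))).ne) hd
      (fun θ hθ => hs.hasDeriv_x hρ h0 hθ) (fun θ hθ => hs.hasDeriv_y hρ h0 hθ)
      hl hr hψl hψr ⟨_, (h0 _ hl).le, rfl, by ring⟩ ⟨_, (h0 _ hr).le, rfl, by ring⟩⟩
    have h1 := mul_neg_of_pos_of_neg p.g_pos (hneg θ hθ)
    have h2 : p.g * (ρ θ * Real.sin θ - P₀ / p.g) = p.g * (ρ θ * Real.sin θ) - P₀ := by
      field_simp
    rw [h2] at h1
    exact h1.ne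
  · rintro ⟨ψ, hs, hψl, hψr, hbij, X, Y, hXY, hsys⟩
    refine ⟨fun θ hθ => ?_, ?_, ?_⟩
    · have hd := (hs.differentiableOn hρ h0 θ hθ).hasDerivWithinAt
      refine (hs.equation_iff h0 hθ hd).2 ?_
      exact p.deriv_slope_of_solvesPsiSystem hsys hlt hbij.mapsTo
        (x := fun s => ρ s * Real.cos s) (y := fun s => ρ s * Real.sin s)
        (fun s hs => (hXY s hs).1) (fun s hs => (hXY s hs).2) hθ hd
        (hs.hasDeriv_x hρ h0 hθ) (hs.hasDeriv_y hρ h0 hθ)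
    · rw [hs.polarDeriv_div hr, hψr, ← p.sin_γ]
      have he : p.θ₂ - p.ψ₂ = p.γ + Real.pi / 2 := by unfold ψ₂; ring
      rw [he, Real.cos_add_pi_div_two, neg_neg]
    · have he : Real.pi - p.θ₁ - p.ψ₁ = -(p.γ - Real.pi / 2) := by unfold ψ₁; ring
      rw [hs.polarDeriv_div hl, hψl, he, Real.cos_neg, Real.cos_sub_pi_div_two, p.sin_γ, neg_neg]

end Setup

theorem theorem2p1 (p : Setup) (hψ₁ : 0 < p.ψ₁) (hψ₂ : p.ψ₂ < 0) (P₀ : ℝ) :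
    -- the shape of a free surface
    (∀ (a b : ℝ) (x y ψ : ℝ → ℝ), p.IsFreeSurface P₀ a b x y ψ → p.SolvesShiftedEL a b x y ψ →
      (∃ tm ∈ Set.Icc a b, y tm < 0 ∧ ∀ t ∈ Set.Icc a b, t ≠ tm → y t < y tm) ∧
      Set.BijOn ψ (Set.Icc a b) (Set.Icc p.ψ₂ p.ψ₁)) ∧
    -- equivalence of the local system with the global system in the parameter `ψ`
    (∀ (a b : ℝ) (x y ψ : ℝ → ℝ), p.IsFreeSurface P₀ a b x y ψ →
      (p.SolvesShiftedEL a b x y ψ ↔ p.SolvesViaSlopeAngle P₀ a b x y ψ)) ∧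
    -- equivalence of the original system for a polar graph with the system in the parameter `ψ`
    (∀ ρ : ℝ → ℝ, ContDiffOn ℝ 2 ρ p.angleRange → (∀ θ ∈ p.angleRange, 0 < ρ θ) →
      (p.SolvesPolarEL P₀ ρ ↔ p.PolarSolvesViaSlopeAngle P₀ ρ)) := by
  exact ⟨fun _ _ _ _ _ h hEL => ⟨h.exists_unique_max hEL hψ₁ hψ₂, h.bijOn_slope hEL hψ₁ hψ₂⟩,
    fun _ _ _ _ _ h => h.solvesShiftedEL_iff hψ₁ hψ₂,
    fun _ hρ h0 => Setup.solvesPolarEL_iff hψ₁ hψ₂ hρ h0⟩
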